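/- Let $0<\ell<\infty$, let $\alpha\in\mathbb R$, and let $A$ and $Q$ be the bounded operators on the complex Hilbert space $L^2(0,\ell)$ given by $$(Af)(x)=xf(x)+i\alpha\int_0^x f(t)\,dt,\qquad (Qf)(x)=xf(x),\qquad 0<x<\ell .$$ Then $A=B^{-1}QB$, where $B$ is a bounded, boundedly invertible operator on $L^2(0,\ell)$, and $B=\mathcal J^{i\alpha}$ and $B^{-1}=\mathcal J^{-i\alpha}$ are the fractional integrals of imaginary order $$(Bf)(x)=\frac{1}{\Gamma(i\alpha+1)}\frac{d}{dx}\int_0^x f(t)(x-t)^{i\alpha}\,dt,\qquad (B^{-1}f)(x)=\frac{1}{\Gamma(-i\alpha+1)}\frac{d}{dx}\int_0^x f(t)(x-t)^{-i\alpha}\,dt,$$ with $\Gamma$ Euler's gamma function. Here, for every $f\in L^2(0,\ell)$, both integrals are absolutely continuous functions of $x\in[0,\ell]$, and the formulas hold for almost every $x\in(0,\ell)$. -/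

import Mathlib

open MeasureTheory Set

/-- Lebesgue measure on the interval `(0, ℓ)`. -/
noncomputable abbrev intervalMeasure (ℓ : ℝ) : Measure ℝ := volume.restrict (Ioo 0 ℓ)

/-- The complex Hilbert space `L²(0, ℓ)`. -/
noncomputable abbrev L2Space (ℓ : ℝ) : Type := Lp ℂ 2 (intervalMeasure ℓ)

theorem memLp_mulId {ℓ : ℝ} (f : L2Space ℓ) :
    MemLp (fun x : ℝ => (x : ℂ) * f x) 2 (intervalMeasure ℓ) := by
  refine MemLp.of_le_mul (c := ℓ) (Lp.memLp f)
    (Complex.measurable_ofReal.aestronglyMeasurable.mul (Lp.aestronglyMeasurable f)) ?_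
  filter_upwards [ae_restrict_mem measurableSet_Ioo] with x hx
  rw [norm_mul, Complex.norm_real, Real.norm_of_nonneg hx.1.le]
  exact mul_le_mul_of_nonneg_right hx.2.le (norm_nonneg _)

/-- The operator `(Q f)(x) = x f(x)` on `L²(0, ℓ)`. -/
noncomputable def mulIdOp (ℓ : ℝ) : L2Space ℓ →L[ℂ] L2Space ℓ :=
  LinearMap.mkContinuous
    { toFun := fun f => (memLp_mulId f).toLp (fun x : ℝ => (x : ℂ) * f x)
      map_add' := by
        intro f g
        rw [← MemLp.toLp_add]
        apply MemLp.toLp_congr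
        filter_upwards [Lp.coeFn_add f g] with x hx
        simp only [hx, Pi.add_apply]
        ring
      map_smul' := by
        intro c f
        rw [RingHom.id_apply, ← MemLp.toLp_const_smul]
        apply MemLp.toLp_congr
        filter_upwards [Lp.coeFn_smul c f] with x hx
        simp only [hx, Pi.smul_apply, smul_eq_mul]
        ring } ℓ (by
    intro f
    refine Lp.norm_le_mul_norm_of_ae_le_mul ?_
    filter_upwards [ae_restrict_mem measurableSet_Ioo, (memLp_mulId f).coeFn_toLp] with x hx h
    simp only [LinearMap.coe_mk, AddHom.coe_mk]
    rw [h, norm_mul, Complex.norm_real, Real.norm_of_nonneg hx.1.le]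
    exact mul_le_mul_of_nonneg_right hx.2.le (norm_nonneg _))

theorem mulIdOp_ae {ℓ : ℝ} (f : L2Space ℓ) :
    mulIdOp ℓ f =ᵐ[intervalMeasure ℓ] fun x => (x : ℂ) * f x :=
  (memLp_mulId f).coeFn_toLp

theorem integrable_L2Space {ℓ : ℝ} (f : L2Space ℓ) : Integrable f (intervalMeasure ℓ) :=
  (Lp.memLp f).integrable (by norm_num)

theorem intervalIntegrable_L2Space {ℓ : ℝ} (f : L2Space ℓ) {x : ℝ} (hx : x ∈ Ioo 0 ℓ) :
    IntervalIntegrable f volume 0 x := by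
  rw [intervalIntegrable_iff_integrableOn_Ioo_of_le hx.1.le]
  exact IntegrableOn.mono_set (integrable_L2Space f) (Ioo_subset_Ioo_right hx.2.le)

theorem norm_integral_le_L2Space {ℓ : ℝ} (f : L2Space ℓ) {x : ℝ} (hx : x ∈ Ioo 0 ℓ) :
    ‖∫ t in (0 : ℝ)..x, f t‖ ≤ ∫ t, ‖f t‖ ∂(intervalMeasure ℓ) := by
  rw [intervalIntegral.integral_of_le hx.1.le, integral_Ioc_eq_integral_Ioo]
  refine (norm_integral_le_integral_norm _).trans ?_
  exact setIntegral_mono_set (integrable_L2Space f).norm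
    (Filter.Eventually.of_forall fun _ => norm_nonneg _)
    (Ioo_subset_Ioo_right hx.2.le).eventuallyLE

theorem memLp_integral {ℓ : ℝ} (f : L2Space ℓ) :
    MemLp (fun x : ℝ => ∫ t in (0 : ℝ)..x, f t) 2 (intervalMeasure ℓ) := by
  have h : ContinuousOn (fun x : ℝ => ∫ t in (0 : ℝ)..x, f t) (Ioo 0 ℓ) := by
    rcases le_or_gt ℓ 0 with h0 | h0
    · simp [Ioo_eq_empty (not_lt.mpr h0)]
    · have hi : IntegrableOn f (uIcc 0 ℓ) volume := by
        rw [uIcc_of_le h0.le, integrableOn_Icc_iff_integrableOn_Ioo]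
        exact integrable_L2Space f
      exact (intervalIntegral.continuousOn_primitive_interval hi).mono
        (by rw [uIcc_of_le h0.le]; exact Ioo_subset_Icc_self)
  refine MemLp.of_bound (h.aestronglyMeasurable measurableSet_Ioo)
    (∫ t, ‖f t‖ ∂(intervalMeasure ℓ)) ?_
  filter_upwards [ae_restrict_mem measurableSet_Ioo] with x hx
  exact norm_integral_le_L2Space f hx

/-- The integration operator `(𝒥 f)(x) = ∫₀ˣ f(t) dt` on `L²(0, ℓ)`, as a linear map. -/
noncomputable def integrationLin (ℓ : ℝ) : L2Space ℓ →ₗ[ℂ] L2Space ℓ where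
  toFun f := (memLp_integral f).toLp (fun x : ℝ => ∫ t in (0 : ℝ)..x, f t)
  map_add' f g := by
    rw [← MemLp.toLp_add]
    apply MemLp.toLp_congr
    filter_upwards [ae_restrict_mem measurableSet_Ioo] with x hx
    rw [Pi.add_apply, ← intervalIntegral.integral_add (intervalIntegrable_L2Space f hx)
      (intervalIntegrable_L2Space g hx)]
    rw [intervalIntegral.integral_of_le hx.1.le, intervalIntegral.integral_of_le hx.1.le,
      integral_Ioc_eq_integral_Ioo, integral_Ioc_eq_integral_Ioo]
    exact integral_congr_ae
      (ae_restrict_of_ae_restrict_of_subset (Ioo_subset_Ioo_right hx.2.le) (Lp.coeFn_add f g))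
  map_smul' c f := by
    rw [RingHom.id_apply, ← MemLp.toLp_const_smul]
    apply MemLp.toLp_congr
    filter_upwards [ae_restrict_mem measurableSet_Ioo] with x hx
    rw [Pi.smul_apply, ← intervalIntegral.integral_smul]
    rw [intervalIntegral.integral_of_le hx.1.le, intervalIntegral.integral_of_le hx.1.le,
      integral_Ioc_eq_integral_Ioo, integral_Ioc_eq_integral_Ioo]
    exact integral_congr_ae
      (ae_restrict_of_ae_restrict_of_subset (Ioo_subset_Ioo_right hx.2.le) (Lp.coeFn_smul c f))

theorem integrationLin_bound (ℓ : ℝ) : ∃ C : ℝ, ∀ f : L2Space ℓ, ‖integrationLin ℓ f‖ ≤ C * ‖f‖ := by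
  have hfin : IsFiniteMeasure (intervalMeasure ℓ) := inferInstance
  set m : ℝ := (intervalMeasure ℓ).real univ ^ ((2 : ENNReal).toReal)⁻¹ with hm
  have hm0 : 0 ≤ m := by positivity
  set K : ℝ := (intervalMeasure ℓ).real univ ^ (1 / 2 : ℝ) with hK
  refine ⟨m * K, fun f => ?_⟩
  have h1 : ∫ t, ‖f t‖ ∂(intervalMeasure ℓ) ≤ ‖f‖ * K := by
    have h := eLpNorm_le_eLpNorm_mul_rpow_measure_univ (μ := intervalMeasure ℓ) (p := 1) (q := 2)
      (by norm_num) (Lp.aestronglyMeasurable f)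
    have h2 := ENNReal.toReal_mono
      (ENNReal.mul_ne_top (Lp.eLpNorm_ne_top f)
        (ENNReal.rpow_ne_top_of_nonneg (by norm_num) (measure_ne_top _ _))) h
    rw [integral_norm_eq_lintegral_enorm (Lp.aestronglyMeasurable f), ← eLpNorm_one_eq_lintegral_enorm]
    refine h2.trans (le_of_eq ?_)
    rw [ENNReal.toReal_mul, ← Lp.norm_def, ← ENNReal.toReal_rpow, hK, Measure.real]
    norm_num
  have h3 : ‖integrationLin ℓ f‖ ≤ m * (∫ t, ‖f t‖ ∂(intervalMeasure ℓ)) := by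
    refine Lp.norm_le_of_ae_bound (integral_nonneg fun _ => norm_nonneg _) ?_
    filter_upwards [ae_restrict_mem measurableSet_Ioo, (memLp_integral f).coeFn_toLp] with x hx h
    have h' : integrationLin ℓ f x = ∫ t in (0 : ℝ)..x, f t := h
    rw [h']
    exact norm_integral_le_L2Space f hx
  calc _ ≤ _ := h3
    _ ≤ m * (‖f‖ * K) := mul_le_mul_of_nonneg_left h1 hm0
    _ = _ := by ring

/-- The integration operator `(𝒥 f)(x) = ∫₀ˣ f(t) dt` as a bounded operator on `L²(0, ℓ)`. -/
noncomputable def integrationOp (ℓ : ℝ) : L2Space ℓ →L[ℂ] L2Space ℓ :=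
  (integrationLin ℓ).mkContinuousOfExistsBound (integrationLin_bound ℓ)

theorem integrationOp_ae {ℓ : ℝ} (f : L2Space ℓ) :
    integrationOp ℓ f =ᵐ[intervalMeasure ℓ] fun x => ∫ t in (0 : ℝ)..x, f t :=
  (memLp_integral f).coeFn_toLp

/-- The triangular Livšic model `(A f)(x) = x f(x) + i α ∫₀ˣ f(t) dt` on `L²(0, ℓ)`. -/
noncomputable def livsicModel (ℓ α : ℝ) : L2Space ℓ →L[ℂ] L2Space ℓ :=
  mulIdOp ℓ + (Complex.I * α) • integrationOp ℓ

theorem livsicModel_ae {ℓ : ℝ} (α : ℝ) (f : L2Space ℓ) :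
    livsicModel ℓ α f =ᵐ[intervalMeasure ℓ]
      fun x => (x : ℂ) * f x + Complex.I * α * ∫ t in (0 : ℝ)..x, f t := by
  have h : livsicModel ℓ α f = mulIdOp ℓ f + (Complex.I * α) • integrationOp ℓ f := rfl
  rw [h]
  filter_upwards [Lp.coeFn_add (mulIdOp ℓ f) ((Complex.I * α) • integrationOp ℓ f),
    Lp.coeFn_smul (Complex.I * (α : ℂ)) (integrationOp ℓ f), mulIdOp_ae f,
    integrationOp_ae f] with x h1 h2 h3 h4
  rw [h1, Pi.add_apply, h2, Pi.smul_apply, h3, h4, smul_eq_mul]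

/-- `x ↦ ∫₀ˣ f(t) (x - t)^s dt`. For `Re s = 0` the kernel has modulus one, so for `f ∈ L²(0, ℓ)`
and `x ∈ [0, ℓ]` this is a convergent Lebesgue integral. -/
noncomputable def powerConvolution (s : ℂ) (f : ℝ → ℂ) (x : ℝ) : ℂ :=
  ∫ t in (0 : ℝ)..x, f t * ((x - t : ℝ) : ℂ) ^ s

/-- The fractional integral `𝒥^s f` of imaginary order `s`:
`(𝒥^s f)(x) = 1 / Γ(s + 1) * d/dx ∫₀ˣ f(t) (x - t)^s dt`. -/
noncomputable def fractionalIntegral (s : ℂ) (f : ℝ → ℂ) (x : ℝ) : ℂ :=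
  1 / Complex.Gamma (s + 1) * deriv (powerConvolution s f) x

/-- The bounded operator `T` on `L²(0, ℓ)` is given by
`(T f)(x) = 1 / Γ(s + 1) * d/dx ∫₀ˣ f(t) (x - t)^s dt`. The derivative is meant in the usual
sense of `L²` theory: for every `f ∈ L²(0, ℓ)` the integral is an absolutely continuous function of
`x ∈ [0, ℓ]`, it is differentiable at almost every `x`, and the formula holds at almost every
`x ∈ (0, ℓ)`. -/
def IsFractionalIntegralOp (ℓ : ℝ) (s : ℂ) (T : L2Space ℓ →L[ℂ] L2Space ℓ) : Prop :=
  ∀ f : L2Space ℓ,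
    AbsolutelyContinuousOnInterval (powerConvolution s f) 0 ℓ ∧
    (∀ᵐ x ∂(intervalMeasure ℓ), DifferentiableAt ℝ (powerConvolution s f) x) ∧
    T f =ᵐ[intervalMeasure ℓ] fractionalIntegral s f

/-!
Conjugation by `e^{-x}` turns the fractional integral `(d/dx)^{-s}` on `(0, ℓ)` into
`(1 + d/dx)^{-s}`, and the weights are harmless on a bounded interval. On `L²(ℝ)` the latter
operator is the Fourier multiplier `(1 + 2πiξ)^{-s}` (`fracMul`). For `Re s = 0` the symbol is
bounded, since `1 + 2πiξ` has bounded argument, and its inverse is the symbol of order `-s`.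

The symbol divided by `1 + 2πiξ` is, up to `Γ(s + 1)`, the Fourier transform of the integrable kernel
`u^s e^{-u}` on `(0, ∞)`. Plancherel's theorem therefore identifies the weighted primitive of
`fracMul s g` with the weighted convolution of `g` with `u^s`
(`Gamma_mul_setIntegral_exp_mul_fracMul`). This one identity gives causality
(`fracMul_ae_eq_zero`), so that compressing the multiplier to `(0, ℓ)` keeps it invertible
(`fracOp_neg_fracOp`), and it says that `Γ(s + 1)` times the primitive of `fracOp s f` is
`∫₀ˣ f(t) (x - t)^s dt` (`Gamma_mul_integral_fracOp`). The absolute continuity of that integral and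
the formula for its derivative follow by Lebesgue's differentiation theorem.

The similarity amounts to `Q 𝒥^s = 𝒥^s (Q + s 𝒥)` for `s = iα` (`mulIdOp_fracOp`). An element of
`L²(0, ℓ)` is determined by its primitive, so it is enough to compare primitives, and there both sides
reduce to `x ∫₀ˣ f(t) (x - t)^s dt - (s + 1)⁻¹ ∫₀ˣ f(t) (x - t)^{s+1} dt`, by Fubini's theorem on a
triangle and `t = x - (x - t)`.
-/

open scoped FourierTransform ComplexConjugate

/-! ### The Laplace transform of a complex power -/

theorem Complex.integrableOn_cpow_mul_exp_neg_mul {a r : ℂ} (ha : 0 < a.re) (hr : 0 < r.re) :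
    IntegrableOn (fun t : ℝ => (t : ℂ) ^ (a - 1) * Complex.exp (-(r * t))) (Ioi 0) := by
  have h := integrableOn_rpow_mul_exp_neg_mul_rpow (s := a.re - 1) (p := 1) (b := r.re)
    (by linarith) one_pos hr
  refine Integrable.mono' h ?_ ?_
  · refine ContinuousOn.aestronglyMeasurable ?_ measurableSet_Ioi
    refine ContinuousOn.mul ?_ (by fun_prop)
    intro t ht
    exact (Complex.continuousAt_ofReal_cpow_const _ _ (Or.inr (ne_of_gt ht))).continuousWithinAt
  · filter_upwards [ae_restrict_mem measurableSet_Ioi] with t ht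
    rw [norm_mul, Complex.norm_cpow_eq_rpow_re_of_pos ht, Complex.norm_exp]
    simp

/-- Laplace transform of a power with complex rate, obtained from the case of a real rate by
analytic continuation in `r`. -/
theorem Complex.integral_cpow_mul_exp_neg_mul_Ioi_of_re_pos {a r : ℂ} (ha : 0 < a.re)
    (hr : 0 < r.re) :
    ∫ t : ℝ in Ioi 0, (t : ℂ) ^ (a - 1) * Complex.exp (-(r * t)) =
      r ^ (-a) * Complex.Gamma a := by
  set U : Set ℂ := {z | 0 < z.re} with hU
  have hUo : IsOpen U := isOpen_lt continuous_const Complex.continuous_re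
  have hUc : IsPreconnected U := (convex_halfSpace_re_gt 0).isPreconnected
  have hd : DifferentiableOn ℂ
      (fun z : ℂ => ∫ t : ℝ in Ioi 0, (t : ℂ) ^ (a - 1) * Complex.exp (-(z * t))) U := by
    intro z hz
    have hz' : 0 < z.re := hz
    have hball : ∀ w ∈ Metric.ball z (z.re / 2), z.re / 2 < w.re := by
      intro w hw
      have h1 := (Complex.abs_re_le_norm (w - z)).trans_lt (mem_ball_iff_norm.1 hw)
      rw [Complex.sub_re, abs_lt] at h1
      linarith
    have hb := integrableOn_rpow_mul_exp_neg_mul_rpow (s := a.re) (p := 1) (b := z.re / 2)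
      (by linarith) one_pos (by linarith)
    refine (hasDerivAt_integral_of_dominated_loc_of_deriv_le
      (F := fun (w : ℂ) (t : ℝ) => (t : ℂ) ^ (a - 1) * Complex.exp (-(w * t)))
      (F' := fun (w : ℂ) (t : ℝ) => (t : ℂ) ^ (a - 1) * (Complex.exp (-(w * t)) * -(t : ℂ)))
      (Metric.ball_mem_nhds z (half_pos hz')) ?_
      (Complex.integrableOn_cpow_mul_exp_neg_mul ha hz') ?_ ?_ hb ?_).2.differentiableAt
      |>.differentiableWithinAt
    · filter_upwards [hUo.mem_nhds hz] with w hw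
      exact (Complex.integrableOn_cpow_mul_exp_neg_mul ha hw).aestronglyMeasurable
    · have := (Complex.integrableOn_cpow_mul_exp_neg_mul ha hz').aestronglyMeasurable.mul
        (Complex.measurable_ofReal.neg.aestronglyMeasurable
          (μ := volume.restrict (Ioi (0 : ℝ))))
      refine this.congr (Filter.Eventually.of_forall fun t => ?_)
      simp [mul_assoc]
    · filter_upwards [ae_restrict_mem measurableSet_Ioi] with t ht w hw
      have ht' : 0 < t := ht
      rw [norm_mul, Complex.norm_cpow_eq_rpow_re_of_pos ht, norm_mul, Complex.norm_exp, norm_neg,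
        Complex.norm_real, Real.norm_of_nonneg ht'.le, Real.rpow_one, Complex.sub_re,
        Complex.one_re, Real.rpow_sub_one ht'.ne']
      have h2 : (-(w * (t : ℂ))).re ≤ -(z.re / 2) * t := by
        simp only [Complex.neg_re, Complex.re_mul_ofReal]
        nlinarith [hball w hw]
      have h3 := Real.exp_le_exp.2 h2
      have h4 : 0 ≤ t ^ a.re := by positivity
      calc t ^ a.re / t * (Real.exp (-(w * (t : ℂ))).re * t)
          = t ^ a.re * Real.exp (-(w * (t : ℂ))).re := by field_simp
        _ ≤ _ := mul_le_mul_of_nonneg_left h3 h4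
    · refine Filter.Eventually.of_forall fun t w _ => ?_
      have : HasDerivAt (fun w : ℂ => -(w * (t : ℂ))) (-(t : ℂ)) w := by
        simpa using ((hasDerivAt_id w).mul_const (t : ℂ)).fun_neg
      exact this.cexp.const_mul _
  have hd2 : DifferentiableOn ℂ (fun z : ℂ => z ^ (-a) * Complex.Gamma a) U := by
    intro z hz
    exact ((differentiableAt_id.cpow_const (Or.inl hz)).mul_const _).differentiableWithinAt
  refine (hd.analyticOnNhd hUo).eqOn_of_preconnected_of_frequently_eq (hd2.analyticOnNhd hUo) hUc
    (z₀ := 1) (by simp [hU]) ?_ hr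
  -- The two sides agree at the real points `1 + 1 / (n + 1)`, which accumulate at `1`.
  have ht : Filter.Tendsto (fun n : ℕ => ((1 + 1 / ((n : ℝ) + 1) : ℝ) : ℂ)) Filter.atTop
      (nhdsWithin 1 {1}ᶜ) := by
    refine tendsto_nhdsWithin_iff.2 ⟨?_, Filter.Eventually.of_forall fun n => ?_⟩
    · have := tendsto_one_div_add_atTop_nhds_zero_nat (𝕜 := ℝ)
      have h2 := (this.const_add 1)
      rw [add_zero] at h2
      exact_mod_cast (Complex.continuous_ofReal.tendsto 1).comp h2
    · have : (1 : ℝ) + 1 / ((n : ℝ) + 1) ≠ 1 := by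
        have : (0 : ℝ) < 1 / ((n : ℝ) + 1) := by positivity
        linarith
      intro h
      exact this (Complex.ofReal_injective (by simpa using h))
  refine ht.frequently (Filter.Frequently.of_forall fun n => ?_)
  have hn : (0 : ℝ) < 1 + 1 / ((n : ℝ) + 1) := by positivity
  rw [Complex.integral_cpow_mul_exp_neg_mul_Ioi ha hn, one_div, Complex.inv_cpow,
    Complex.cpow_neg]
  rw [Complex.arg_ofReal_of_nonneg hn.le]
  exact Real.pi_pos.ne

/-! ### The Plancherel transform on `L¹ ∩ L²` -/

/-- On `L¹ ∩ L²` the Plancherel extension of the Fourier transform is given by the usual integral: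
both have the same pairing with every test function. -/
theorem MeasureTheory.MemLp.fourier_toLp_ae_eq {f : ℝ → ℂ} (h1 : Integrable f)
    (h2 : MemLp f 2 volume) :
    (𝓕 (h2.toLp f) : Lp ℂ 2 (volume : Measure ℝ)) =ᵐ[volume] 𝓕 f := by
  have hc : Continuous (𝓕 f) :=
    VectorFourier.fourierIntegral_continuous Real.continuous_fourierChar
      (by fun_prop) h1
  refine ae_eq_of_integral_contDiff_smul_eq
    ((Lp.memLp _).locallyIntegrable (by norm_num)) hc.locallyIntegrable fun φ hφ hφc => ?_
  have hφ' : ContDiff ℝ ((⊤ : ℕ∞) : WithTop ℕ∞) fun x => (φ x : ℂ) :=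
    Complex.ofRealCLM.contDiff.comp hφ
  have hφc' : HasCompactSupport fun x => (φ x : ℂ) := hφc.comp_left Complex.ofReal_zero
  set ψ : SchwartzMap ℝ ℂ := hφc'.toSchwartzMap hφ' with hψ
  have e1 := congrArg (fun T => T ψ) (Lp.fourier_toTemperedDistribution_eq (h2.toLp f))
  simp only [TemperedDistribution.fourier_apply, Lp.toTemperedDistribution_apply] at e1
  have e2 : ∫ x, (𝓕 ψ) x • (h2.toLp f) x = ∫ x, (𝓕 ψ) x • f x :=
    integral_congr_ae (h2.coeFn_toLp.mono fun x hx => by simp only [hx])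
  rw [e2, SchwartzMap.fourier_coe] at e1
  have e3 := VectorFourier.integral_fourierIntegral_smul_eq_flip (μ := volume) (ν := volume)
    (L := innerₗ ℝ) (f := (ψ : ℝ → ℂ)) (g := f)
    Real.continuous_fourierChar (by fun_prop) ψ.integrable h1
  have e4 : (innerₗ ℝ).flip = innerₗ ℝ := by ext; simp
  rw [e4] at e3
  have e5 : ∀ u : ℝ → ℂ, ∫ x, φ x • u x = ∫ x, ψ x • u x := fun u => by
    refine integral_congr_ae (Filter.Eventually.of_forall fun x => ?_)
    change φ x • u x = ((φ x : ℂ)) • u x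
    simp
  rw [e5, e5, ← e1]
  exact e3

/-! ### Multiplication and extension by zero on `L²` -/

theorem memLp_bounded_mul {μ : Measure ℝ} {a : ℝ → ℂ} {C : ℝ} (hm : AEStronglyMeasurable a μ)
    (hb : ∀ᵐ x ∂μ, ‖a x‖ ≤ C) (f : Lp ℂ 2 μ) : MemLp (fun x => a x * f x) 2 μ :=
  MemLp.of_le_mul (c := C) (Lp.memLp f) (hm.mul (Lp.aestronglyMeasurable f)) (by
    filter_upwards [hb] with x hx
    rw [norm_mul]
    exact mul_le_mul_of_nonneg_right hx (norm_nonneg _))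

/-- Multiplication by a bounded measurable function `a`, as a bounded operator on `L²(μ)`. -/
noncomputable def mulL2 {μ : Measure ℝ} (a : ℝ → ℂ) (C : ℝ) (hm : AEStronglyMeasurable a μ)
    (hb : ∀ᵐ x ∂μ, ‖a x‖ ≤ C) : Lp ℂ 2 μ →L[ℂ] Lp ℂ 2 μ :=
  LinearMap.mkContinuous
    { toFun := fun f => (memLp_bounded_mul hm hb f).toLp (fun x => a x * f x)
      map_add' := by
        intro f g
        rw [← MemLp.toLp_add]
        apply MemLp.toLp_congr
        filter_upwards [Lp.coeFn_add f g] with x hx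
        simp only [hx, Pi.add_apply]
        ring
      map_smul' := by
        intro c f
        rw [RingHom.id_apply, ← MemLp.toLp_const_smul]
        apply MemLp.toLp_congr
        filter_upwards [Lp.coeFn_smul c f] with x hx
        simp only [hx, Pi.smul_apply, smul_eq_mul]
        ring } C (by
    intro f
    refine Lp.norm_le_mul_norm_of_ae_le_mul ?_
    filter_upwards [hb, (memLp_bounded_mul hm hb f).coeFn_toLp] with x hx h
    simp only [LinearMap.coe_mk, AddHom.coe_mk]
    rw [h, norm_mul]
    exact mul_le_mul_of_nonneg_right hx (norm_nonneg _))

theorem mulL2_ae {μ : Measure ℝ} (a : ℝ → ℂ) (C : ℝ) (hm : AEStronglyMeasurable a μ)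
    (hb : ∀ᵐ x ∂μ, ‖a x‖ ≤ C) (f : Lp ℂ 2 μ) :
    mulL2 a C hm hb f =ᵐ[μ] fun x => a x * f x :=
  (memLp_bounded_mul hm hb f).coeFn_toLp

theorem memLp_indicator_Lp {S : Set ℝ} (hS : MeasurableSet S) (f : Lp ℂ 2 (volume.restrict S)) :
    MemLp (S.indicator f) 2 volume :=
  (memLp_indicator_iff_restrict hS).2 (Lp.memLp f)

/-- Extension by zero of a function on `S`, as a bounded operator `L²(S) → L²(ℝ)`. -/
noncomputable def extendL2 (S : Set ℝ) (hS : MeasurableSet S) :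
    Lp ℂ 2 (volume.restrict S) →L[ℂ] Lp ℂ 2 (volume : Measure ℝ) :=
  LinearMap.mkContinuous
    { toFun := fun f => (memLp_indicator_Lp hS f).toLp (S.indicator f)
      map_add' := by
        intro f g
        rw [← MemLp.toLp_add]
        apply MemLp.toLp_congr
        filter_upwards [(ae_restrict_iff' hS).1 (Lp.coeFn_add f g)] with x hx
        by_cases h : x ∈ S
        · simpa [h] using hx h
        · simp [h]
      map_smul' := by
        intro c f
        rw [RingHom.id_apply, ← MemLp.toLp_const_smul]
        apply MemLp.toLp_congr
        filter_upwards [(ae_restrict_iff' hS).1 (Lp.coeFn_smul c f)] with x hx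
        by_cases h : x ∈ S
        · simpa [h] using hx h
        · simp [h] } 1 (by
    intro f
    simp only [LinearMap.coe_mk, AddHom.coe_mk]
    rw [Lp.norm_toLp, Lp.norm_def, eLpNorm_indicator_eq_eLpNorm_restrict hS, one_mul])

theorem extendL2_ae (S : Set ℝ) (hS : MeasurableSet S) (f : Lp ℂ 2 (volume.restrict S)) :
    extendL2 S hS f =ᵐ[volume] S.indicator f :=
  (memLp_indicator_Lp hS f).coeFn_toLp

/-! ### The damped power kernel and its Fourier transform -/

/-- The damped power kernel `u ↦ u^s e^{-u}` on `(0, ∞)`, extended by zero. -/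
noncomputable def fracKernel (s : ℂ) : ℝ → ℂ :=
  (Ioi (0 : ℝ)).indicator fun u => (u : ℂ) ^ s * Complex.exp (-u)

theorem integrable_fracKernel {s : ℂ} (hs : s.re = 0) : Integrable (fracKernel s) := by
  rw [fracKernel, integrable_indicator_iff measurableSet_Ioi]
  have := Complex.integrableOn_cpow_mul_exp_neg_mul (a := s + 1) (r := 1) (by simp [hs]) (by simp)
  simpa using this

theorem norm_fracKernel_le {s : ℂ} (hs : s.re = 0) (u : ℝ) : ‖fracKernel s u‖ ≤ 1 := by
  by_cases hu : 0 < u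
  · rw [fracKernel, indicator_of_mem (mem_Ioi.2 hu), norm_mul,
      Complex.norm_cpow_eq_rpow_re_of_pos hu, hs, Real.rpow_zero, one_mul, Complex.norm_exp]
    simpa using hu.le
  · rw [fracKernel, indicator_of_notMem (by simpa using hu)]
    simp

theorem fourier_fracKernel {s : ℂ} (hs : s.re = 0) (ξ : ℝ) :
    𝓕 (fracKernel s) ξ =
      (1 + 2 * Real.pi * ξ * Complex.I) ^ (-(s + 1)) * Complex.Gamma (s + 1) := by
  rw [← Complex.integral_cpow_mul_exp_neg_mul_Ioi_of_re_pos (by simp [hs]) (by simp),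
    Real.fourier_real_eq_integral_exp_smul, ← integral_indicator measurableSet_Ioi]
  refine integral_congr_ae (Filter.Eventually.of_forall fun u => ?_)
  simp only [fracKernel, indicator, smul_eq_mul]
  split_ifs
  · rw [mul_left_comm, ← Complex.exp_add, add_sub_cancel_right]
    congr 2
    push_cast
    ring
  · simp

theorem integrable_conj_fracKernel_sub {s : ℂ} (hs : s.re = 0) (x : ℝ) :
    Integrable fun t => conj (fracKernel s (x - t)) := by
  have := (integrable_fracKernel hs).comp_sub_left x
  exact (LinearIsometryEquiv.integrable_comp_iff Complex.conjLIE).2 this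

theorem memLp_conj_fracKernel_sub {s : ℂ} (hs : s.re = 0) (x : ℝ) :
    MemLp (fun t => conj (fracKernel s (x - t))) 2 volume := by
  have h := integrable_conj_fracKernel_sub hs x
  rw [memLp_two_iff_integrable_sq_norm h.aestronglyMeasurable]
  refine h.norm.mono' (h.aestronglyMeasurable.norm.pow 2) (Filter.Eventually.of_forall fun t => ?_)
  rw [Real.norm_of_nonneg (by positivity), sq]
  refine mul_le_of_le_one_left (norm_nonneg _) ?_
  rw [RCLike.norm_conj]
  exact norm_fracKernel_le hs _

theorem fourier_conj_fracKernel_sub {s : ℂ} (x ξ : ℝ) :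
    𝓕 (fun t => conj (fracKernel s (x - t))) ξ =
      conj (Complex.exp (2 * Real.pi * x * ξ * Complex.I) * 𝓕 (fracKernel s) ξ) := by
  rw [Real.fourier_real_eq_integral_exp_smul, Real.fourier_real_eq_integral_exp_smul,
    ← integral_const_mul, ← integral_conj]
  rw [← integral_sub_left_eq_self _ volume x]
  refine integral_congr_ae (Filter.Eventually.of_forall fun u => ?_)
  simp only [smul_eq_mul, sub_sub_cancel, map_mul]
  rw [← mul_assoc, ← Complex.exp_conj, ← Complex.exp_conj, ← Complex.exp_add]
  congr 2
  simp only [map_mul, Complex.conj_ofReal, Complex.conj_I, map_ofNat]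
  push_cast
  ring

/-- Plancherel's theorem for the convolution of the kernel with an `L²` function. -/
theorem integral_fracKernel_mul {s : ℂ} (hs : s.re = 0) (g : Lp ℂ 2 (volume : Measure ℝ))
    (x : ℝ) :
    ∫ t, fracKernel s (x - t) * g t =
      ∫ ξ : ℝ, Complex.exp (2 * Real.pi * x * ξ * Complex.I) * 𝓕 (fracKernel s) ξ *
        (𝓕 g : Lp ℂ 2 (volume : Measure ℝ)) ξ := by
  -- The convolution at `x` is the inner product of `g` with `t ↦ conj (fracKernel s (x - t))`.
  have h := Lp.inner_fourier_eq ((memLp_conj_fracKernel_sub hs x).toLp _) g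
  rw [L2.inner_def, L2.inner_def] at h
  refine Eq.trans (integral_congr_ae ?_) (h.symm.trans (integral_congr_ae ?_))
  · filter_upwards [(memLp_conj_fracKernel_sub hs x).coeFn_toLp] with t ht
    rw [ht, RCLike.inner_apply, Complex.conj_conj, mul_comm]
  · filter_upwards [(memLp_conj_fracKernel_sub hs x).fourier_toLp_ae_eq
      (integrable_conj_fracKernel_sub hs x)] with ξ hξ
    rw [hξ, fourier_conj_fracKernel_sub, RCLike.inner_apply, Complex.conj_conj, mul_comm]

/-! ### The Fourier multiplier and its causality -/

theorem one_add_mul_I_ne_zero (ξ : ℝ) : (1 + 2 * Real.pi * ξ * Complex.I : ℂ) ≠ 0 := by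
  intro h
  simpa using congrArg Complex.re h

/-- The Fourier symbol of the damped fractional integral of order `s`. -/
noncomputable def fracSymbol (s : ℂ) (ξ : ℝ) : ℂ := (1 + 2 * Real.pi * ξ * Complex.I) ^ (-s)

theorem measurable_fracSymbol (s : ℂ) : Measurable (fracSymbol s) := by
  unfold fracSymbol
  fun_prop

theorem norm_fracSymbol_le {s : ℂ} (hs : s.re = 0) (ξ : ℝ) :
    ‖fracSymbol s ξ‖ ≤ Real.exp (Real.pi * |s.im|) := by
  rw [fracSymbol, Complex.norm_cpow_of_ne_zero (one_add_mul_I_ne_zero ξ), Complex.neg_re, hs,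
    neg_zero, Real.rpow_zero, one_div, ← Real.exp_neg, Complex.neg_im, mul_neg, neg_neg]
  refine Real.exp_le_exp.2 ((le_abs_self _).trans ?_)
  rw [abs_mul]
  exact mul_le_mul_of_nonneg_right (Complex.abs_arg_le_pi _) (abs_nonneg _)

theorem fracSymbol_mul_fracSymbol_neg (s : ℂ) (ξ : ℝ) :
    fracSymbol (-s) ξ * fracSymbol s ξ = 1 := by
  rw [fracSymbol, fracSymbol, ← Complex.cpow_add _ _ (one_add_mul_I_ne_zero ξ)]
  simp

/-- The Fourier multiplier `(1 + 2πiξ)^{-s}` on `L²(ℝ)`: the damped fractional integral of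
imaginary order `s`, that is `(1 + d/dx)^{-s}`. -/
noncomputable def fracMul (s : ℂ) (hs : s.re = 0) :
    Lp ℂ 2 (volume : Measure ℝ) →L[ℂ] Lp ℂ 2 (volume : Measure ℝ) :=
  ((Lp.fourierTransformₗᵢ ℝ ℂ).symm.toContinuousLinearEquiv :
      Lp ℂ 2 (volume : Measure ℝ) →L[ℂ] Lp ℂ 2 (volume : Measure ℝ)) ∘L
    mulL2 (fracSymbol s) _ (measurable_fracSymbol s).aestronglyMeasurable
      (Filter.Eventually.of_forall (norm_fracSymbol_le hs)) ∘L
    ((Lp.fourierTransformₗᵢ ℝ ℂ).toContinuousLinearEquiv :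
      Lp ℂ 2 (volume : Measure ℝ) →L[ℂ] Lp ℂ 2 (volume : Measure ℝ))

theorem fourier_fracMul_ae {s : ℂ} (hs : s.re = 0) (g : Lp ℂ 2 (volume : Measure ℝ)) :
    (𝓕 (fracMul s hs g) : Lp ℂ 2 (volume : Measure ℝ)) =ᵐ[volume]
      fun ξ => fracSymbol s ξ * (𝓕 g : Lp ℂ 2 (volume : Measure ℝ)) ξ := by
  have : (𝓕 (fracMul s hs g) : Lp ℂ 2 (volume : Measure ℝ)) =
      mulL2 (fracSymbol s) _ (measurable_fracSymbol s).aestronglyMeasurable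
      (Filter.Eventually.of_forall (norm_fracSymbol_le hs)) (𝓕 g) :=
    (Lp.fourierTransformₗᵢ ℝ ℂ).apply_symm_apply _
  rw [this]
  exact mulL2_ae _ _ _ _ _

theorem fracMul_neg_fracMul {s : ℂ} (hs : s.re = 0) (hs' : (-s).re = 0)
    (g : Lp ℂ 2 (volume : Measure ℝ)) : fracMul (-s) hs' (fracMul s hs g) = g := by
  apply (Lp.fourierTransformₗᵢ ℝ ℂ).injective
  apply Lp.ext
  filter_upwards [fourier_fracMul_ae hs g, fourier_fracMul_ae hs' (fracMul s hs g)] with ξ h1 h2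
  refine h2.trans ?_
  rw [h1, ← mul_assoc, fracSymbol_mul_fracSymbol_neg, one_mul]
  rfl

theorem integral_fracKernel_zero_mul_fracMul {s : ℂ} (hs : s.re = 0)
    (g : Lp ℂ 2 (volume : Measure ℝ)) (x : ℝ) :
    Complex.Gamma (s + 1) * ∫ t, fracKernel 0 (x - t) * fracMul s hs g t =
      ∫ t, fracKernel s (x - t) * g t := by
  rw [integral_fracKernel_mul Complex.zero_re, integral_fracKernel_mul hs,
    ← integral_const_mul]
  refine integral_congr_ae ?_
  filter_upwards [fourier_fracMul_ae hs g] with ξ h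
  rw [h, fourier_fracKernel hs, fourier_fracKernel Complex.zero_re, fracSymbol, zero_add,
    Complex.Gamma_one, neg_add, Complex.cpow_add _ _ (one_add_mul_I_ne_zero ξ)]
  ring

/-- The defining property of `fracMul`: its weighted primitive is the weighted fractional integral
of order `s + 1`. -/
theorem Gamma_mul_setIntegral_exp_mul_fracMul {s : ℂ} (hs : s.re = 0)
    (g : Lp ℂ 2 (volume : Measure ℝ)) (x : ℝ) :
    Complex.Gamma (s + 1) * ∫ t : ℝ in Iio x, Complex.exp t * fracMul s hs g t =
      ∫ t : ℝ in Iio x, ((x - t : ℝ) : ℂ) ^ s * Complex.exp t * g t := by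
  -- `e^t = e^x e^{-(x - t)}` turns the kernel into the weight `e^t` on `(-∞, x)`.
  have key : ∀ (z : ℂ) (h : ℝ → ℂ), ∫ t : ℝ in Iio x, ((x - t : ℝ) : ℂ) ^ z * Complex.exp t * h t =
      Complex.exp x * ∫ t, fracKernel z (x - t) * h t := by
    intro z h
    rw [← integral_indicator measurableSet_Iio, ← integral_const_mul]
    refine integral_congr_ae (Filter.Eventually.of_forall fun t : ℝ => ?_)
    by_cases ht : t < x
    · rw [indicator_of_mem (mem_Iio.2 ht)]
      simp only [fracKernel]
      rw [indicator_of_mem (mem_Ioi.2 (sub_pos.2 ht))]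
      have : Complex.exp t = Complex.exp x * Complex.exp (-((x - t : ℝ) : ℂ)) := by
        rw [← Complex.exp_add]
        congr 1
        push_cast
        ring
      rw [this]
      ring
    · rw [indicator_of_notMem (by simpa using ht)]
      simp only [fracKernel]
      rw [indicator_of_notMem (by simpa using ht)]
      simp
  rw [key, ← integral_fracKernel_zero_mul_fracMul hs]
  have := key 0 (fracMul s hs g)
  simp only [Complex.cpow_zero, one_mul] at this
  rw [this]
  ring

theorem integrableOn_exp_mul_Iio (g : Lp ℂ 2 (volume : Measure ℝ)) (x : ℝ) :
    IntegrableOn (fun t : ℝ => Complex.exp t * g t) (Iio x) := by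
  have hexp : MemLp (fun t : ℝ => Complex.exp t) 2 (volume.restrict (Iio x)) := by
    rw [memLp_two_iff_integrable_sq_norm (by fun_prop)]
    have h : IntegrableOn (fun t : ℝ => Real.exp (2 * t)) (Iio x) :=
      (integrableOn_exp_mul_Iic two_pos x).mono_set Iio_subset_Iic_self
    refine h.congr (Filter.Eventually.of_forall fun t => ?_)
    simp [Complex.norm_exp, ← Real.exp_nat_mul]
  exact hexp.integrable_mul ((Lp.memLp g).restrict _)

theorem ae_eq_zero_of_forall_setIntegral_Iio_eq_zero {h : ℝ → ℂ} {a : ℝ}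
    (hi : IntegrableOn h (Iio a)) (hz : ∀ x < a, ∫ t in Iio x, h t = 0) :
    ∀ᵐ x, x < a → h x = 0 := by
  have hg : Integrable ((Iio a).indicator h) := (integrable_indicator_iff measurableSet_Iio).2 hi
  filter_upwards [LocallyIntegrable.ae_hasDerivAt_integral hg.locallyIntegrable] with x hx hxa
  have h1 := hx x
  have h2 : ∀ y < a, ∫ t in Iic y, (Iio a).indicator h t = 0 := by
    intro y hy
    rw [integral_Iic_eq_integral_Iio, ← hz y hy]
    refine setIntegral_congr_fun measurableSet_Iio fun t ht => ?_
    exact indicator_of_mem (mem_Iio.2 (lt_trans ht hy)) _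
  have h3 : (fun y => ∫ t in x..y, (Iio a).indicator h t) =ᶠ[nhds x] fun _ => 0 := by
    filter_upwards [Iio_mem_nhds hxa] with y hy
    rw [← intervalIntegral.integral_Iic_sub_Iic hg.integrableOn hg.integrableOn, h2 y hy, h2 x hxa,
      sub_zero]
  have h4 := h1.unique ((hasDerivAt_const x (0 : ℂ)).congr_of_eventuallyEq h3)
  rwa [indicator_of_mem (mem_Iio.2 hxa)] at h4

/-- Causality: the values of `fracMul s g` on a left half-line depend only on those of `g` there.
The weighted primitive of `fracMul s g` vanishes on the half-line, hence so does its derivative. -/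
theorem fracMul_ae_eq_zero {s : ℂ} (hs : s.re = 0) {g : Lp ℂ 2 (volume : Measure ℝ)} {a : ℝ}
    (hg : ∀ᵐ x, x < a → g x = 0) : ∀ᵐ x, x < a → fracMul s hs g x = 0 := by
  have h := ae_eq_zero_of_forall_setIntegral_Iio_eq_zero (a := a)
    (h := fun t : ℝ => Complex.exp t * fracMul s hs g t)
    (integrableOn_exp_mul_Iio _ a) (fun x hx => ?_)
  · filter_upwards [h] with x hx hxa
    exact (mul_eq_zero.1 (hx hxa)).resolve_left (Complex.exp_ne_zero _)
  · have h1 := Gamma_mul_setIntegral_exp_mul_fracMul hs g x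
    have h2 : ∫ t : ℝ in Iio x, ((x - t : ℝ) : ℂ) ^ s * Complex.exp t * g t = 0 := by
      refine integral_eq_zero_of_ae ?_
      filter_upwards [ae_restrict_mem measurableSet_Iio, ae_restrict_of_ae hg] with t ht h
      simp [h (lt_trans ht hx)]
    rw [h2] at h1
    exact (mul_eq_zero.1 h1).resolve_left (Complex.Gamma_ne_zero_of_re_pos (by simp [hs]))

/-! ### The fractional integral on a bounded interval -/

/-- The embedding `f ↦ e^{-t} f(t)`, extended by zero, of `L²(0, ℓ)` into `L²(ℝ)`. -/
noncomputable def dampExtend (ℓ : ℝ) : L2Space ℓ →L[ℂ] Lp ℂ 2 (volume : Measure ℝ) :=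
  extendL2 (Ioo 0 ℓ) measurableSet_Ioo ∘L
    mulL2 (fun t : ℝ => Complex.exp (-t)) 1 (by fun_prop) (by
      filter_upwards [ae_restrict_mem measurableSet_Ioo] with t ht
      simpa [Complex.norm_exp] using ht.1.le)

theorem dampExtend_ae {ℓ : ℝ} (f : L2Space ℓ) :
    dampExtend ℓ f =ᵐ[volume] (Ioo 0 ℓ).indicator fun t => Complex.exp (-t) * f t := by
  refine (extendL2_ae _ measurableSet_Ioo _).trans ?_
  refine (ae_eq_restrict_iff_indicator_ae_eq measurableSet_Ioo).1 ?_
  exact mulL2_ae _ _ _ _ f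

/-- The operator `h ↦ e^x h(x)`, restricted to `(0, ℓ)`, from `L²(ℝ)` to `L²(0, ℓ)`; a left inverse
of `dampExtend`. -/
noncomputable def undampRestrict (ℓ : ℝ) : Lp ℂ 2 (volume : Measure ℝ) →L[ℂ] L2Space ℓ :=
  mulL2 (fun t : ℝ => Complex.exp t) (Real.exp ℓ) (by fun_prop) (by
      filter_upwards [ae_restrict_mem measurableSet_Ioo] with t ht
      simpa [Complex.norm_exp] using ht.2.le) ∘L
    LpToLpRestrictCLM ℝ ℂ ℂ volume 2 (Ioo 0 ℓ)

theorem undampRestrict_ae {ℓ : ℝ} (h : Lp ℂ 2 (volume : Measure ℝ)) :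
    undampRestrict ℓ h =ᵐ[intervalMeasure ℓ] fun x => Complex.exp x * h x := by
  have e : undampRestrict ℓ h =ᵐ[intervalMeasure ℓ]
      fun x => Complex.exp x * LpToLpRestrictCLM ℝ ℂ ℂ volume 2 (Ioo 0 ℓ) h x := by
    rw [undampRestrict, ContinuousLinearMap.comp_apply]
    exact mulL2_ae _ _ _ _ _
  refine e.trans ?_
  filter_upwards [LpToLpRestrictCLM_coeFn ℂ (Ioo 0 ℓ) h] with x hx
  rw [hx]

/-- The fractional integral of imaginary order `s` as a bounded operator on `L²(0, ℓ)`. The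
exponential weights turn the symbol `(d/dx)^{-s}` into `(1 + d/dx)^{-s}`. -/
noncomputable def fracOp (s : ℂ) (hs : s.re = 0) (ℓ : ℝ) : L2Space ℓ →L[ℂ] L2Space ℓ :=
  undampRestrict ℓ ∘L fracMul s hs ∘L dampExtend ℓ

theorem fracMul_dampExtend_ae_eq_zero {s : ℂ} (hs : s.re = 0) {ℓ : ℝ} (f : L2Space ℓ) :
    ∀ᵐ t, t < 0 → fracMul s hs (dampExtend ℓ f) t = 0 := by
  refine fracMul_ae_eq_zero hs ?_
  filter_upwards [dampExtend_ae f] with t ht h0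
  rw [ht, indicator_of_notMem fun h => h0.not_gt h.1]

/-- The primitive of `fracOp s f` is the fractional integral of `f` of order `s + 1`. -/
theorem Gamma_mul_integral_fracOp {s : ℂ} (hs : s.re = 0) {ℓ : ℝ} (f : L2Space ℓ) {x : ℝ}
    (hx : x ∈ Icc 0 ℓ) :
    Complex.Gamma (s + 1) * ∫ t in (0 : ℝ)..x, fracOp s hs ℓ f t = powerConvolution s f x := by
  set h := fracMul s hs (dampExtend ℓ f) with hh
  have hsub : Ioo 0 x ⊆ Iio x := fun t ht => ht.2
  have hne : ∀ᵐ t : ℝ, t ≠ 0 := by simp [ae_iff]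
  have e1 : ∫ t in (0 : ℝ)..x, fracOp s hs ℓ f t = ∫ t : ℝ in Iio x, Complex.exp t * h t := by
    rw [intervalIntegral.integral_of_le hx.1, integral_Ioc_eq_integral_Ioo]
    refine Eq.trans ?_ (setIntegral_eq_of_subset_of_ae_sdiff_eq_zero
      measurableSet_Iio.nullMeasurableSet hsub ?_).symm
    · exact integral_congr_ae (ae_restrict_of_ae_restrict_of_subset
        (Ioo_subset_Ioo_right hx.2) (undampRestrict_ae h))
    · filter_upwards [fracMul_dampExtend_ae_eq_zero hs f, hne] with t ht h0 htm
      have : t < 0 := lt_of_le_of_ne (not_lt.1 fun h1 => htm.2 ⟨h1, htm.1⟩) h0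
      rw [hh, ht this, mul_zero]
  have e2 : powerConvolution s f x =
      ∫ t : ℝ in Iio x, ((x - t : ℝ) : ℂ) ^ s * Complex.exp t * dampExtend ℓ f t := by
    rw [powerConvolution, intervalIntegral.integral_of_le hx.1, integral_Ioc_eq_integral_Ioo]
    refine Eq.trans ?_ (setIntegral_eq_of_subset_of_ae_sdiff_eq_zero
      measurableSet_Iio.nullMeasurableSet hsub ?_).symm
    · refine integral_congr_ae ?_
      filter_upwards [ae_restrict_of_ae (dampExtend_ae f), ae_restrict_mem measurableSet_Ioo]
        with t ht htm
      rw [ht, indicator_of_mem (Ioo_subset_Ioo_right hx.2 htm), Complex.exp_neg]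
      field_simp
    · filter_upwards [dampExtend_ae f] with t ht htm
      rw [ht, indicator_of_notMem fun h1 => htm.2 ⟨h1.1, htm.1⟩, mul_zero]
  rw [e1, e2]
  exact Gamma_mul_setIntegral_exp_mul_fracMul hs _ x

theorem fracOp_neg_fracOp {s : ℂ} (hs : s.re = 0) (hs' : (-s).re = 0) {ℓ : ℝ} (f : L2Space ℓ) :
    fracOp (-s) hs' ℓ (fracOp s hs ℓ f) = f := by
  set h := fracMul s hs (dampExtend ℓ f) with hh
  set g := dampExtend ℓ (fracOp s hs ℓ f) with hg
  have hne : ∀ᵐ t : ℝ, t ≠ 0 := by simp [ae_iff]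
  -- Cutting off at `ℓ` does not matter, by causality.
  have hgh : ∀ᵐ t, t < ℓ → (g - h) t = 0 := by
    filter_upwards [dampExtend_ae (fracOp s hs ℓ f), fracMul_dampExtend_ae_eq_zero hs f, hne,
      Lp.coeFn_sub g h, (ae_restrict_iff' measurableSet_Ioo).1 (undampRestrict_ae (ℓ := ℓ) h)]
      with t h1 h2 h3 h4 h5 ht
    rw [h4, Pi.sub_apply, hg, h1, sub_eq_zero]
    rcases lt_or_gt_of_ne h3 with h0 | h0
    · rw [h2 h0, indicator_of_notMem fun h => h0.not_gt h.1]
    · have h6 : fracOp s hs ℓ f t = Complex.exp t * h t := h5 ⟨h0, ht⟩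
      rw [indicator_of_mem (show t ∈ Ioo 0 ℓ from ⟨h0, ht⟩), h6, Complex.exp_neg]
      field_simp
  have h7 := fracMul_ae_eq_zero hs' hgh
  rw [map_sub, hh, fracMul_neg_fracMul hs hs'] at h7
  apply Lp.ext
  refine (undampRestrict_ae (fracMul (-s) hs' g)).trans ?_
  filter_upwards [ae_restrict_mem measurableSet_Ioo, ae_restrict_of_ae h7,
    ae_restrict_of_ae (Lp.coeFn_sub (fracMul (-s) hs' g) (dampExtend ℓ f)),
    ae_restrict_of_ae (dampExtend_ae f)] with t ht h8 h9 h10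
  have h11 := h8 ht.2
  rw [h9, Pi.sub_apply, sub_eq_zero] at h11
  rw [h11, h10, indicator_of_mem ht, Complex.exp_neg]
  field_simp

/-! ### Primitives, absolute continuity and differentiation -/

theorem intervalIntegrable_L2Space_full {ℓ : ℝ} (hℓ : 0 < ℓ) (f : L2Space ℓ) :
    IntervalIntegrable f volume 0 ℓ := by
  rw [intervalIntegrable_iff_integrableOn_Ioo_of_le hℓ.le]
  exact integrable_L2Space f

theorem ae_hasDerivAt_primitive {ℓ : ℝ} (hℓ : 0 < ℓ) (f : L2Space ℓ) :
    ∀ᵐ x ∂intervalMeasure ℓ, HasDerivAt (fun y => ∫ t in (0 : ℝ)..y, f t) (f x) x := by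
  refine (ae_restrict_iff' measurableSet_Ioo).2 ?_
  filter_upwards [(intervalIntegrable_L2Space_full hℓ f).ae_hasDerivAt_integral] with x hx hxm
  refine hx ?_ 0 left_mem_uIcc
  rw [uIcc_of_le hℓ.le]
  exact Ioo_subset_Icc_self hxm

theorem L2Space.ext_of_primitive_eq {ℓ : ℝ} (hℓ : 0 < ℓ) {f g : L2Space ℓ}
    (h : ∀ x ∈ Ioo 0 ℓ, ∫ t in (0 : ℝ)..x, f t = ∫ t in (0 : ℝ)..x, g t) : f = g := by
  apply Lp.ext
  filter_upwards [ae_hasDerivAt_primitive hℓ f, ae_hasDerivAt_primitive hℓ g,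
    ae_restrict_mem measurableSet_Ioo] with x h1 h2 hx
  refine h1.unique (h2.congr_of_eventuallyEq ?_)
  filter_upwards [isOpen_Ioo.mem_nhds hx] with y hy using h y hy

theorem AbsolutelyContinuousOnInterval.congr {f g : ℝ → ℂ} {a b : ℝ}
    (hf : AbsolutelyContinuousOnInterval f a b) (h : EqOn f g (uIcc a b)) :
    AbsolutelyContinuousOnInterval g a b := by
  refine Filter.Tendsto.congr' ?_ hf
  filter_upwards [Filter.mem_inf_of_right (Filter.mem_principal_self _)] with E hE
  refine Finset.sum_congr rfl fun i hi => ?_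
  rw [h (hE.1 i hi).1, h (hE.1 i hi).2]

theorem IntervalIntegrable.absolutelyContinuousOnInterval_primitive {f : ℝ → ℂ} {a b : ℝ}
    (hf : IntervalIntegrable f volume a b) :
    AbsolutelyContinuousOnInterval (fun x => ∫ t in a..x, f t) a b := by
  have hre : IntervalIntegrable (fun t => (f t).re) volume a b := ⟨hf.1.re, hf.2.re⟩
  have him : IntervalIntegrable (fun t => (f t).im) volume a b := ⟨hf.1.im, hf.2.im⟩
  have cast : ∀ {u : ℝ → ℝ}, AbsolutelyContinuousOnInterval u a b →
      AbsolutelyContinuousOnInterval (fun x => (u x : ℂ)) a b := fun hu =>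
    Filter.Tendsto.congr (fun E => Finset.sum_congr rfl fun i _ =>
      (Complex.isometry_ofReal.dist_eq _ _).symm) hu
  have h := (cast (hre.absolutelyContinuousOnInterval_intervalIntegral left_mem_uIcc)).add
    ((cast (him.absolutelyContinuousOnInterval_intervalIntegral left_mem_uIcc)).const_smul
      Complex.I)
  refine h.congr fun x hx => ?_
  have hfx : IntervalIntegrable f volume a x :=
    hf.mono_set (uIcc_subset_uIcc left_mem_uIcc hx)
  simp only [Pi.add_apply, smul_eq_mul]
  rw [← intervalIntegral.integral_ofReal, ← intervalIntegral.integral_ofReal,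
    ← intervalIntegral.integral_const_mul, ← intervalIntegral.integral_add]
  · refine intervalIntegral.integral_congr fun t _ => ?_
    rw [mul_comm Complex.I, Complex.re_add_im]
  · exact ⟨hfx.1.re.ofReal, hfx.2.re.ofReal⟩
  · exact IntervalIntegrable.const_mul ⟨hfx.1.im.ofReal, hfx.2.im.ofReal⟩ _

theorem isFractionalIntegralOp_fracOp {s : ℂ} (hs : s.re = 0) {ℓ : ℝ} (hℓ : 0 < ℓ) :
    IsFractionalIntegralOp ℓ s (fracOp s hs ℓ) := by
  intro f
  have hΓ : Complex.Gamma (s + 1) ≠ 0 := Complex.Gamma_ne_zero_of_re_pos (by simp [hs])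
  have hd : ∀ᵐ x ∂intervalMeasure ℓ, HasDerivAt (powerConvolution s f)
      (Complex.Gamma (s + 1) * fracOp s hs ℓ f x) x := by
    filter_upwards [ae_hasDerivAt_primitive hℓ (fracOp s hs ℓ f),
      ae_restrict_mem measurableSet_Ioo] with x h1 hx
    refine (h1.const_mul (Complex.Gamma (s + 1))).congr_of_eventuallyEq ?_
    filter_upwards [isOpen_Ioo.mem_nhds hx] with y hy
    exact (Gamma_mul_integral_fracOp hs f (Ioo_subset_Icc_self hy)).symm
  refine ⟨?_, hd.mono fun x h => h.differentiableAt, ?_⟩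
  · refine (((intervalIntegrable_L2Space_full hℓ
      (fracOp s hs ℓ f)).absolutelyContinuousOnInterval_primitive).const_smul
      (Complex.Gamma (s + 1))).congr fun x hx => ?_
    rw [uIcc_of_le hℓ.le] at hx
    exact Gamma_mul_integral_fracOp hs f hx
  · filter_upwards [hd] with x h
    rw [fractionalIntegral, h.deriv]
    field_simp

/-! ### Fractional integrals, integration and multiplication by the variable -/

/-- Fubini's theorem on the triangle `0 < t < y < x`, for a kernel bounded by one. -/
theorem integral_triangle_swap {u : ℝ → ℂ} {x : ℝ} (hu : IntegrableOn u (Ioo 0 x))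
    {K : ℝ → ℝ → ℂ} (hK : Measurable (Function.uncurry K))
    (hb : ∀ y t, t < y → y < x → ‖K y t‖ ≤ 1) :
    ∫ y in Ioo 0 x, ∫ t in Ioo 0 y, u t * K y t =
      ∫ t in Ioo 0 x, u t * ∫ y in Ioo t x, K y t := by
  set μ := (volume : Measure ℝ).restrict (Ioo 0 x) with hμ
  set H : ℝ → ℝ → ℂ := fun y t => if t < y ∧ y < x then u t * K y t else 0 with hH
  have hS : MeasurableSet {p : ℝ × ℝ | p.2 < p.1 ∧ p.1 < x} :=
    (measurableSet_lt measurable_snd measurable_fst).inter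
      (measurableSet_lt measurable_fst measurable_const)
  have hu2 : Integrable (fun p : ℝ × ℝ => u p.2) (μ.prod μ) := Integrable.comp_snd hu μ
  have hHi : Integrable (Function.uncurry H) (μ.prod μ) := by
    have hm : AEStronglyMeasurable ({p : ℝ × ℝ | p.2 < p.1 ∧ p.1 < x}.indicator
        fun p : ℝ × ℝ => u p.2 * Function.uncurry K p) (μ.prod μ) :=
      (hu2.aestronglyMeasurable.mul hK.aestronglyMeasurable).indicator hS
    refine hu2.norm.mono' (hm.congr (Filter.Eventually.of_forall fun p => ?_))
      (Filter.Eventually.of_forall fun p => ?_)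
    · simp [indicator, hH, Function.uncurry]
    · simp only [hH, Function.uncurry]
      split_ifs with h
      · rw [norm_mul]
        exact mul_le_of_le_one_right (norm_nonneg _) (hb _ _ h.1 h.2)
      · simp
  have e1 : ∫ y in Ioo 0 x, ∫ t in Ioo 0 y, u t * K y t = ∫ y, ∫ t, H y t ∂μ ∂μ := by
    refine setIntegral_congr_fun measurableSet_Ioo fun y hy => ?_
    rw [hμ, ← integral_indicator measurableSet_Ioo, ← integral_indicator measurableSet_Ioo]
    congr 1
    ext t
    simp only [indicator, mem_Ioo, hH]
    have := hy.2
    split_ifs <;> first | rfl | (exfalso; grind)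
  have e2 : ∫ t in Ioo 0 x, u t * ∫ y in Ioo t x, K y t = ∫ t, ∫ y, H y t ∂μ ∂μ := by
    refine setIntegral_congr_fun measurableSet_Ioo fun t ht => ?_
    rw [hμ, ← integral_const_mul, ← integral_indicator measurableSet_Ioo,
      ← integral_indicator measurableSet_Ioo]
    congr 1
    ext y
    simp only [indicator, mem_Ioo, hH]
    have := ht.1
    split_ifs <;> first | rfl | (exfalso; grind)
  rw [e1, e2]
  exact integral_integral_swap hHi

theorem norm_ofReal_cpow_of_re_eq_zero {s : ℂ} (hs : s.re = 0) {v : ℝ} (hv : 0 < v) :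
    ‖(v : ℂ) ^ s‖ = 1 := by
  rw [Complex.norm_cpow_eq_rpow_re_of_pos hv, hs, Real.rpow_zero]

theorem powerConvolution_eq_setIntegral (s : ℂ) (f : ℝ → ℂ) {x : ℝ} (hx : 0 ≤ x) :
    powerConvolution s f x = ∫ t in Ioo 0 x, f t * ((x - t : ℝ) : ℂ) ^ s := by
  rw [powerConvolution, intervalIntegral.integral_of_le hx, integral_Ioc_eq_integral_Ioo]

theorem powerConvolution_congr (s : ℂ) {f g : ℝ → ℂ} {ℓ x : ℝ} (hx : x ∈ Ioo 0 ℓ)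
    (h : f =ᵐ[intervalMeasure ℓ] g) : powerConvolution s f x = powerConvolution s g x := by
  rw [powerConvolution_eq_setIntegral s f hx.1.le, powerConvolution_eq_setIntegral s g hx.1.le]
  refine integral_congr_ae ?_
  filter_upwards [ae_restrict_of_ae_restrict_of_subset (Ioo_subset_Ioo_right hx.2.le) h] with t ht
  rw [ht]

theorem add_one_ne_zero_of_re_eq_zero {s : ℂ} (hs : s.re = 0) : s + 1 ≠ 0 := fun h => by
  simpa [hs] using congrArg Complex.re h

theorem integral_zero_cpow {s : ℂ} (hs : s.re = 0) (v : ℝ) :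
    ∫ w in (0 : ℝ)..v, (w : ℂ) ^ s = (v : ℂ) ^ (s + 1) / (s + 1) := by
  rw [integral_cpow (Or.inl (by rw [hs]; norm_num)), Complex.ofReal_zero,
    Complex.zero_cpow (add_one_ne_zero_of_re_eq_zero hs), sub_zero]

theorem measurable_ofReal_cpow (s : ℂ) : Measurable fun v : ℝ => (v : ℂ) ^ s :=
  Complex.measurable_ofReal.pow_const s

/-- `𝒥 𝒥^{s+1} = 𝒥^{s+2}`, up to Gamma factors. -/
theorem integral_powerConvolution {s : ℂ} (hs : s.re = 0) {u : ℝ → ℂ} {x : ℝ} (hx : 0 ≤ x)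
    (hu : IntegrableOn u (Ioo 0 x)) :
    ∫ y in (0 : ℝ)..x, powerConvolution s u y = powerConvolution (s + 1) u x / (s + 1) := by
  have h := integral_triangle_swap hu (K := fun y t => ((y - t : ℝ) : ℂ) ^ s)
    ((measurable_ofReal_cpow s).comp (measurable_fst.sub measurable_snd))
    (fun y t ht _ => (norm_ofReal_cpow_of_re_eq_zero hs (sub_pos.2 ht)).le)
  rw [intervalIntegral.integral_of_le hx, integral_Ioc_eq_integral_Ioo,
    powerConvolution_eq_setIntegral _ _ hx, ← integral_div]
  refine Eq.trans (setIntegral_congr_fun measurableSet_Ioo fun y hy => ?_) (h.trans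
    (setIntegral_congr_fun measurableSet_Ioo fun t ht => ?_))
  · exact powerConvolution_eq_setIntegral _ _ hy.1.le
  · rw [← integral_Ioc_eq_integral_Ioo, ← intervalIntegral.integral_of_le ht.2.le,
      intervalIntegral.integral_comp_sub_right (fun w : ℝ => (w : ℂ) ^ s) t, sub_self,
      integral_zero_cpow hs, mul_div_assoc]

/-- `𝒥^{s+1} 𝒥 = 𝒥^{s+2}`, up to Gamma factors. -/
theorem powerConvolution_integral {s : ℂ} (hs : s.re = 0) {u : ℝ → ℂ} {x : ℝ} (hx : 0 ≤ x)
    (hu : IntegrableOn u (Ioo 0 x)) :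
    powerConvolution s (fun y => ∫ t in (0 : ℝ)..y, u t) x =
      powerConvolution (s + 1) u x / (s + 1) := by
  have h := integral_triangle_swap hu (K := fun y _ => ((x - y : ℝ) : ℂ) ^ s)
    ((measurable_ofReal_cpow s).comp (measurable_const.sub measurable_fst))
    (fun y t _ hy => (norm_ofReal_cpow_of_re_eq_zero hs (sub_pos.2 hy)).le)
  rw [powerConvolution_eq_setIntegral _ _ hx, powerConvolution_eq_setIntegral _ _ hx,
    ← integral_div]
  refine Eq.trans (setIntegral_congr_fun measurableSet_Ioo fun y hy => ?_) (h.trans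
    (setIntegral_congr_fun measurableSet_Ioo fun t ht => ?_))
  · rw [integral_mul_const, intervalIntegral.integral_of_le hy.1.le, integral_Ioc_eq_integral_Ioo]
  · rw [← integral_Ioc_eq_integral_Ioo, ← intervalIntegral.integral_of_le ht.2.le,
      intervalIntegral.integral_comp_sub_left (fun w : ℝ => (w : ℂ) ^ s) x, sub_self,
      integral_zero_cpow hs, mul_div_assoc]

theorem integrableOn_mul_cpow_sub {s : ℂ} (hs : 0 ≤ s.re) {u : ℝ → ℂ} {x : ℝ}
    (hu : IntegrableOn u (Ioo 0 x)) :
    IntegrableOn (fun t => u t * ((x - t : ℝ) : ℂ) ^ s) (Ioo 0 x) := by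
  refine Integrable.mul_bdd (c := x ^ s.re) hu
    ((measurable_ofReal_cpow s).comp (measurable_const.sub measurable_id)).aestronglyMeasurable ?_
  filter_upwards [ae_restrict_mem measurableSet_Ioo] with t ht
  rw [Complex.norm_cpow_eq_rpow_re_of_pos (sub_pos.2 ht.2)]
  exact Real.rpow_le_rpow (sub_pos.2 ht.2).le (by linarith [ht.1]) hs

/-- The commutator of a fractional integral with multiplication by `x`, from `t = x - (x - t)`. -/
theorem powerConvolution_id_mul {s : ℂ} (hs : s.re = 0) {u : ℝ → ℂ} {x : ℝ} (hx : 0 ≤ x)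
    (hu : IntegrableOn u (Ioo 0 x)) :
    powerConvolution s (fun t => (t : ℂ) * u t) x =
      x * powerConvolution s u x - powerConvolution (s + 1) u x := by
  rw [powerConvolution_eq_setIntegral _ _ hx, powerConvolution_eq_setIntegral _ _ hx,
    powerConvolution_eq_setIntegral _ _ hx, ← integral_const_mul,
    ← integral_sub ((integrableOn_mul_cpow_sub hs.ge hu).const_mul _)
      (integrableOn_mul_cpow_sub (by simp [hs]) hu)]
  refine setIntegral_congr_fun measurableSet_Ioo fun t ht => ?_
  have hne : ((x - t : ℝ) : ℂ) ≠ 0 := by exact_mod_cast (sub_pos.2 ht.2).ne'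
  rw [Complex.cpow_add _ _ hne, Complex.cpow_one]
  push_cast
  ring

/-- The intertwining relation `Q 𝒥^s = 𝒥^s (Q + s 𝒥)`, verified on primitives. -/
theorem mulIdOp_fracOp {s : ℂ} (hs : s.re = 0) {ℓ : ℝ} (hℓ : 0 < ℓ) (f : L2Space ℓ) :
    mulIdOp ℓ (fracOp s hs ℓ f) = fracOp s hs ℓ (mulIdOp ℓ f + s • integrationOp ℓ f) := by
  have hΓ : Complex.Gamma (s + 1) ≠ 0 := Complex.Gamma_ne_zero_of_re_pos (by simp [hs])
  have hs1 := add_one_ne_zero_of_re_eq_zero hs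
  refine L2Space.ext_of_primitive_eq hℓ fun x hx => mul_left_cancel₀ hΓ ?_
  have hint : ∀ g : L2Space ℓ, IntegrableOn g (Ioo 0 x) := fun g =>
    IntegrableOn.mono_set (integrable_L2Space g) (Ioo_subset_Ioo_right hx.2.le)
  have zeroPow : ∀ (u : ℝ → ℂ) (y : ℝ), powerConvolution 0 u y = ∫ t in (0 : ℝ)..y, u t :=
    fun u y => by simp [powerConvolution]
  set T := fracOp s hs ℓ with hT
  have hTf : ∀ y ∈ Icc 0 ℓ,
      Complex.Gamma (s + 1) * ∫ t in (0 : ℝ)..y, T f t = powerConvolution s f y :=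
    fun y hy => Gamma_mul_integral_fracOp hs f hy
  have hxI : x ∈ Icc 0 ℓ := Ioo_subset_Icc_self hx
  have lhs : Complex.Gamma (s + 1) * ∫ t in (0 : ℝ)..x, mulIdOp ℓ (T f) t =
      x * powerConvolution s f x - powerConvolution (s + 1) f x / (s + 1) := by
    rw [← zeroPow, powerConvolution_congr 0 hx (mulIdOp_ae (T f)),
      powerConvolution_id_mul Complex.zero_re hx.1.le (hint _), mul_sub, zeroPow, mul_left_comm,
      hTf x hxI]
    congr 1
    have h1 := integral_powerConvolution Complex.zero_re hx.1.le (hint (T f))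
    rw [zero_add, div_one] at h1
    rw [zero_add, ← h1, ← intervalIntegral.integral_const_mul,
      ← integral_powerConvolution hs hx.1.le (hint f)]
    refine intervalIntegral.integral_congr fun y hy => ?_
    rw [uIcc_of_le hx.1.le] at hy
    rw [zeroPow, hTf y ⟨hy.1, hy.2.trans hx.2.le⟩]
  have rhs : Complex.Gamma (s + 1) *
      ∫ t in (0 : ℝ)..x, T (mulIdOp ℓ f + s • integrationOp ℓ f) t =
      powerConvolution s (mulIdOp ℓ f) x + s * powerConvolution s (integrationOp ℓ f) x := by
    rw [hT, Gamma_mul_integral_fracOp hs _ hxI]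
    simp only [powerConvolution_eq_setIntegral _ _ hx.1.le]
    rw [← integral_const_mul, ← integral_add (integrableOn_mul_cpow_sub hs.ge (hint _))
      ((integrableOn_mul_cpow_sub hs.ge (hint _)).const_mul _)]
    refine integral_congr_ae (ae_restrict_of_ae_restrict_of_subset
      (Ioo_subset_Ioo_right hx.2.le) ?_)
    filter_upwards [Lp.coeFn_add (mulIdOp ℓ f) (s • integrationOp ℓ f),
      Lp.coeFn_smul s (integrationOp ℓ f)] with t h1 h2
    rw [h1, Pi.add_apply, h2, Pi.smul_apply, smul_eq_mul]
    ring
  rw [lhs, rhs, powerConvolution_congr s hx (mulIdOp_ae f),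
    powerConvolution_congr s hx (integrationOp_ae f),
    powerConvolution_id_mul hs hx.1.le (hint f), powerConvolution_integral hs hx.1.le (hint f)]
  field_simp
  ring

theorem theorem9p1 (ℓ : ℝ) (hℓ : 0 < ℓ) (α : ℝ) :
    ∃ B : L2Space ℓ ≃L[ℂ] L2Space ℓ,
      IsFractionalIntegralOp ℓ (Complex.I * α) B ∧
      IsFractionalIntegralOp ℓ (-(Complex.I * α)) B.symm ∧
      livsicModel ℓ α =
        (B.symm : L2Space ℓ →L[ℂ] L2Space ℓ) ∘L mulIdOp ℓ ∘L (B : L2Space ℓ →L[ℂ] L2Space ℓ) := by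
  have hs : (Complex.I * α : ℂ).re = 0 := by simp
  have hs' : (-(Complex.I * α) : ℂ).re = 0 := by simp
  have hinv : ∀ f, fracOp (Complex.I * α) hs ℓ (fracOp (-(Complex.I * α)) hs' ℓ f) = f := by
    intro f
    have h := fracOp_neg_fracOp hs' (by simp) f
    simpa only [neg_neg] using h
  refine ⟨ContinuousLinearEquiv.equivOfInverse (fracOp (Complex.I * α) hs ℓ)
    (fracOp (-(Complex.I * α)) hs' ℓ) (fracOp_neg_fracOp hs hs') hinv,
    isFractionalIntegralOp_fracOp hs hℓ, isFractionalIntegralOp_fracOp hs' hℓ, ?_⟩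
  ext1 f
  exact (fracOp_neg_fracOp hs hs' (livsicModel ℓ α f)).symm.trans
    (congrArg _ (mulIdOp_fracOp hs hℓ f).symm)
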